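/- Let $D$ be a set of domains. A model consists of: a structural equation model $Z_i=f_i(\mathrm{PA}(Z_i),\epsilon_i;\theta_i)$, $i=1,\dots,n$, over a directed acyclic graph, with real variables, measurable $f_i$ and mutually independent real noises $\epsilon_i$ whose laws do not depend on the domain; a parameter value $\theta^{(u)}=(\theta^{(u)}_1,\dots,\theta^{(u)}_n)$ for each domain $u\in D$; and a map $g:\mathbb{R}^n\to\mathbb{R}^d$ that is a $\mathcal{C}^2$-diffeomorphism onto its image ($\mathcal C^2$, a homeomorphism onto its image, with injective derivative everywhere). The observed vector is $X=g(Z)$. The Markov network $\mathcal{M}_Z$ of the model is the graph on $\{Z_1,\dots,Z_n\}$ in which distinct $Z_i,Z_j$ are non-adjacent if and only if, in every domain, $Z_i$ and $Z_j$ are conditionally independent given the remaining variables $Z_{[n]\setminus\{i,j\}}$; $|\mathcal{M}_Z|$ is its number of edges. Consider a true model $(g,f,Z,\theta)$ and an estimated model $(\hat g,\hat f,\hat Z,\hat\theta)$ of this kind, with the same $n$, $d$ and $D$ (the graphs, mechanisms, noises and parameters may differ), such that $X$ and $\hat X=\hat g(\hat Z)$ have the same law in every domain. Assume: (A1) for every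 $u\in D$ the law of $Z$ in the domain $u$ has a density $p(\cdot;\theta^{(u)})$ that is twice continuously differentiable and positive on $\mathbb{R}^n$; (A2) for every $z\in\mathbb{R}^n$ there are $2n+|\mathcal{M}_Z|+1$ domains $u_0,u_1,\dots,u_{2n+|\mathcal{M}_Z|}\in D$ such that the vectors $w(z,u_r)-w(z,u_0)$, $r=1,\dots,2n+|\mathcal{M}_Z|$, are linearly independent, where $$w(z,u)=\Big(\tfrac{\partial \log p(z;\theta^{(u)})}{\partial z_i}\Big)_{i\in[n]}\oplus\Big(\tfrac{\partial^2 \log p(z;\theta^{(u)})}{\partial z_i^2}\Big)_{i\in[n]}\oplus\Big(\tfrac{\partial^2 \log p(z;\theta^{(u)})}{\partial z_i\,\partial z_j}\Big)_{i<j,\ \{Z_i,Z_j\}\in\mathcal{E}(\mathcal{M}_Z)}.$$ Let $W=\hat g^{-1}(g(\mathbb{R}^n))$ and let $v=g^{-1}\circ\hat g:W\to\mathbb{R}^n$, so that $Z=v(\hat Z)$ (if $g$ and $\hat g$ have the same image, then $W=\mathbb{R}^n$). Then $W$ is open, $\hat Z\in W$ almost surely in every domain, $v$ is of class $\mathcal{C}^2$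 on $W$, and for every two distinct $\hat Z_k,\hat Z_l$ that are not adjacent in $\mathcal{M}_{\hat Z}$ and every point $\hat z\in W$, the partial derivatives $\frac{\partial Z_i}{\partial\hat Z_k}=\frac{\partial v_i}{\partial \hat z_k}(\hat z)$ satisfy (a) $\frac{\partial Z_i}{\partial\hat Z_k}\frac{\partial Z_i}{\partial\hat Z_l}=0$ for every $i\in[n]$; (b) $\frac{\partial Z_i}{\partial\hat Z_k}\frac{\partial Z_j}{\partial\hat Z_l}=0$ for all $i,j$ such that $Z_i$ and $Z_j$ are adjacent in $\mathcal{M}_Z$. -/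

import Mathlib

open MeasureTheory ProbabilityTheory Set

noncomputable section

/-- An acyclic structural equation model `Z i = f i (PA (Z i), ε i; θ i)`, `i = 1, …, n`, with
real-valued variables and mutually independent exogenous noises. The parameter `θ i` of the
`i`-th mechanism ranges over the type `Par i`. -/
structure LatentSEM (n : ℕ) (Par : Fin n → Type*) where
  /-- `PA i` is the set of parents of the `i`-th variable. -/
  PA : Fin n → Finset (Fin n)
  /-- The directed graph with an edge `j → i` for every `j ∈ PA i` has no directed cycle. -/
  acyclic : ∀ i, ¬ Relation.TransGen (fun j i => j ∈ PA i) i i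
  /-- The mechanisms. -/
  f : ∀ i, (PA i → ℝ) → ℝ → Par i → ℝ
  measurable_f : ∀ i (t : Par i), Measurable fun q : (PA i → ℝ) × ℝ => f i q.1 q.2 t
  /-- The law of the `i`-th noise. -/
  noise : Fin n → Measure ℝ
  noise_prob : ∀ i, IsProbabilityMeasure (noise i)

namespace LatentSEM

variable {n : ℕ} {Par : Fin n → Type*}

theorem wellFounded_parent (S : LatentSEM n Par) :
    WellFounded (fun j i => j ∈ S.PA i) := by
  have : Std.Irrefl (Relation.TransGen fun j i => j ∈ S.PA i) := ⟨S.acyclic⟩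
  exact Subrelation.wf (fun h => Relation.TransGen.single h)
    (Finite.wellFounded_of_trans_of_irrefl (Relation.TransGen fun j i => j ∈ S.PA i))

/-- The latent vector determined by the parameter `θ` and the noise `e`, computed recursively
along the graph. -/
def solution (S : LatentSEM n Par) (θ : ∀ i, Par i) (e : Fin n → ℝ) : Fin n → ℝ :=
  S.wellFounded_parent.fix fun i z => S.f i (fun j => z j.1 j.2) (e i) (θ i)

/-- The structural equations. -/
theorem solution_eq (S : LatentSEM n Par) (θ : ∀ i, Par i) (e : Fin n → ℝ) (i : Fin n) :
    S.solution θ e i = S.f i (fun j => S.solution θ e j.1) (e i) (θ i) := by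
  unfold solution
  rw [WellFounded.fix_eq]

theorem measurable_solution (S : LatentSEM n Par) (θ : ∀ i, Par i) :
    Measurable (S.solution θ) := by
  refine measurable_pi_iff.2 fun i => ?_
  induction i using S.wellFounded_parent.induction with
  | _ i ih =>
    simp only [S.solution_eq θ _ i]
    exact (S.measurable_f i (θ i)).comp
      ((measurable_pi_iff.2 fun j => ih j.1 j.2).prodMk (measurable_pi_apply i))

/-- The law `P_{Z;θ}` of the latent vector when the noises are independent. -/
def law (S : LatentSEM n Par) (θ : ∀ i, Par i) : Measure (Fin n → ℝ) :=
  (Measure.pi S.noise).map (S.solution θ)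

instance (S : LatentSEM n Par) (θ : ∀ i, Par i) : IsProbabilityMeasure (S.law θ) := by
  have := S.noise_prob
  exact Measure.isProbabilityMeasure_map (S.measurable_solution θ).aemeasurable

end LatentSEM

/-- `g : ℝⁿ → ℝᵈ` is a `C²`-diffeomorphism onto its image: it is of class `C²`, a homeomorphism
onto its image, and its derivative is injective at every point. -/
structure IsC2DiffeoOntoImage {n d : ℕ} (g : (Fin n → ℝ) → (Fin d → ℝ)) : Prop where
  contDiff : ContDiff ℝ 2 g
  isEmbedding : Topology.IsEmbedding g
  injective_fderiv : ∀ z, Function.Injective (fderiv ℝ g z)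

/-- The data generating process `X = g(Z)`, `Z i = f i (PA (Z i), ε i; θ i)`, in the domains
`u : Dom`; the domain `u` has the parameter `θ u`. -/
structure GenerativeModel (n d : ℕ) (Par : Fin n → Type*) (Dom : Type*) where
  sem : LatentSEM n Par
  θ : Dom → ∀ i, Par i
  g : (Fin n → ℝ) → (Fin d → ℝ)
  diffeo : IsC2DiffeoOntoImage g

namespace GenerativeModel

variable {n d : ℕ} {Par Par' : Fin n → Type*} {Dom : Type*}

/-- The law of the latent vector `Z` in the domain `u`. -/
def latentLaw (M : GenerativeModel n d Par Dom) (u : Dom) : Measure (Fin n → ℝ) :=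
  M.sem.law (M.θ u)

instance (M : GenerativeModel n d Par Dom) (u : Dom) : IsProbabilityMeasure (M.latentLaw u) :=
  inferInstanceAs (IsProbabilityMeasure (M.sem.law (M.θ u)))

/-- The law of the observed vector `X = g(Z)` in the domain `u`. -/
def observedLaw (M : GenerativeModel n d Par Dom) (u : Dom) : Measure (Fin d → ℝ) :=
  (M.latentLaw u).map M.g

end GenerativeModel

/-- Under the law `μ` of a random vector `Z`, the coordinates `Z i` and `Z j` are conditionally
independent given all the other coordinates. -/
def CondIndepGivenRest {n : ℕ} (μ : Measure (Fin n → ℝ)) [IsFiniteMeasure μ] (i j : Fin n) :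
    Prop :=
  CondIndepFun (cylinderEvents ({i, j}ᶜ : Set (Fin n))) cylinderEvents_le_pi
    (fun z : Fin n → ℝ => z i) (fun z : Fin n → ℝ => z j) μ

theorem CondIndepGivenRest.symm {n : ℕ} {μ : Measure (Fin n → ℝ)} [IsFiniteMeasure μ]
    {i j : Fin n} (h : CondIndepGivenRest μ i j) : CondIndepGivenRest μ j i := by
  unfold CondIndepGivenRest at h ⊢
  simp only [Set.pair_comm j i]
  exact CondIndepFun.symm h

/-- The Markov network over the latent variables: `i` and `j` are not adjacent if and only if
`Z i` and `Z j` are conditionally independent given the other variables, in every domain. -/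
def GenerativeModel.markovNetwork {n d : ℕ} {Par : Fin n → Type*} {Dom : Type*}
    (M : GenerativeModel n d Par Dom) : SimpleGraph (Fin n) where
  Adj i j := i ≠ j ∧ ¬ ∀ u, CondIndepGivenRest (M.latentLaw u) i j
  symm := ⟨fun _ _ h => ⟨h.1.symm, fun h' => h.2 fun u => (h' u).symm⟩⟩
  loopless := ⟨fun _ h => h.1 rfl⟩

/-- The partial derivative `∂F/∂z_i` of a function on `ℝⁿ`. -/
def partialD {n : ℕ} (i : Fin n) (F : (Fin n → ℝ) → ℝ) (z : Fin n → ℝ) : ℝ :=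
  fderiv ℝ F z (Pi.single i 1)

/-- The vector `w(z)` of the first derivatives, the pure second derivatives, and the mixed second
derivatives along the edges `{i, j}`, `i < j`, of the graph `G`, of `log p` at `z`. -/
def changeVector {n : ℕ} (G : SimpleGraph (Fin n)) (p : (Fin n → ℝ) → ℝ) (z : Fin n → ℝ) :
    Fin n ⊕ Fin n ⊕ {e : Fin n × Fin n // e.1 < e.2 ∧ G.Adj e.1 e.2} → ℝ :=
  Sum.elim (fun i => partialD i (fun y => Real.log (p y)) z)
    (Sum.elim (fun i => partialD i (partialD i fun y => Real.log (p y)) z)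
      (fun e => partialD e.1.1 (partialD e.1.2 fun y => Real.log (p y)) z))

/-- Smooth and positive density: `p u` is a density of the law of the latent vector in the domain `u`, and it is twice
continuously differentiable and positive on `ℝⁿ`. -/
def SmoothPositiveDensity {n d : ℕ} {Par : Fin n → Type*} {Dom : Type*}
    (M : GenerativeModel n d Par Dom) (p : Dom → (Fin n → ℝ) → ℝ) : Prop :=
  ∀ u, M.latentLaw u = volume.withDensity (fun z => ENNReal.ofReal (p u z)) ∧
    ContDiff ℝ 2 (p u) ∧ ∀ z, 0 < p u z

/-- Sufficient changes: for every `z` there are `2n + |M_Z| + 1` domains `τ 0, τ 1, …` for which the vectors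
`w(z, τ k) - w(z, τ 0)`, `1 ≤ k ≤ 2n + |M_Z|`, are linearly independent. -/
def SufficientChanges {n d : ℕ} {Par : Fin n → Type*} {Dom : Type*}
    (M : GenerativeModel n d Par Dom) (p : Dom → (Fin n → ℝ) → ℝ) : Prop :=
  ∀ z, ∃ τ : Fin (2 * n + M.markovNetwork.edgeSet.ncard + 1) → Dom,
    LinearIndependent ℝ fun k : Fin (2 * n + M.markovNetwork.edgeSet.ncard) =>
      changeVector M.markovNetwork (p (τ k.succ)) z - changeVector M.markovNetwork (p (τ 0)) z

/-- The map `v = g⁻¹ ∘ ĝ`, which expresses the true latent vector `Z` through the estimated one.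
It is meaningful on `latentDomain M N`. -/
def latentMap {n d : ℕ} {Par Par' : Fin n → Type*} {Dom : Type*}
    (M : GenerativeModel n d Par Dom) (N : GenerativeModel n d Par' Dom) :
    (Fin n → ℝ) → (Fin n → ℝ) :=
  Function.invFun M.g ∘ N.g

/-- The set of the estimated latent values `ẑ` whose observation `ĝ(ẑ)` is of the form `g(z)`. -/
def latentDomain {n d : ℕ} {Par Par' : Fin n → Type*} {Dom : Type*}
    (M : GenerativeModel n d Par Dom) (N : GenerativeModel n d Par' Dom) :
    Set (Fin n → ℝ) :=
  N.g ⁻¹' Set.range M.g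

/-- The partial derivative `∂Z_i/∂Ẑ_k` of the `i`-th component of `Z = v(Ẑ)` at `ẑ`. -/
def dLatent {n d : ℕ} {Par Par' : Fin n → Type*} {Dom : Type*}
    (M : GenerativeModel n d Par Dom) (N : GenerativeModel n d Par' Dom)
    (i k : Fin n) (zh : Fin n → ℝ) : ℝ :=
  partialD k (fun y => latentMap M N y i) zh

end

open Filter Topology

/-! Equality of the observed laws gives `Ẑ` the density `|det Dv| · p u ∘ v` on `W`. If `k, l` are
not adjacent in the estimated network, then near each point of `W` the logarithm of this density is
additive in the coordinates `k` and `l`. The Jacobian factor is the same in every domain, so it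
cancels in the log-ratio of two domains, whose mixed derivative in `k, l` therefore vanishes
(`partialD_partialD_log_ratio_eq_zero`).

Expanded by the second-order chain rule, this is a linear equation in the difference of two vectors
`w(z, u)`: mixed derivatives of `log p` at non-adjacent pairs of the true network vanish by the same
factorization argument. The coefficients are `∂²v_i/∂k∂l`, `∂_k v_i ∂_l v_i`, and `∂_k v_i ∂_l v_j +
∂_k v_j ∂_l v_i` on edges. Sufficient changes supply as many independent equations as unknowns, so
all coefficients are zero (`dLatent_relations`). The vanishing diagonal products then split the
symmetric edge sums into single products.

Two points need care. Conditional independence is a statement about kernels up to null sets, and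
`CondIndepGivenRest.density_mul_density` turns it into a pointwise identity. Openness of `W` is not
assumed and comes from full measure together with local closedness of the images. -/

/-! ### Conditional independence and pointwise factorization of densities. -/

theorem cylinderEvents_eq_comap_restrict {ι : Type*} {X : ι → Type*}
    [∀ i, MeasurableSpace (X i)] (Δ : Set ι) :
    (cylinderEvents Δ : MeasurableSpace (∀ i, X i)) =
      MeasurableSpace.comap (fun x (i : Δ) => x i) MeasurableSpace.pi := by
  simp only [cylinderEvents, MeasurableSpace.pi, MeasurableSpace.comap_iSup,
    MeasurableSpace.comap_comp, Function.comp_def, iSup_subtype]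

theorem condIndepFun_congr_measurableSpace {Ω β γ : Type*} {m₁ m₂ mΩ : MeasurableSpace Ω}
    [StandardBorelSpace Ω] [MeasurableSpace β] [MeasurableSpace γ] {μ : Measure Ω}
    [IsFiniteMeasure μ] {f : Ω → β} {g : Ω → γ} (h : m₁ = m₂) (h₁ : m₁ ≤ mΩ) (h₂ : m₂ ≤ mΩ) :
    CondIndepFun m₁ h₁ f g μ ↔ CondIndepFun m₂ h₂ f g μ := by
  subst h; rfl

open Classical in
/-- Separation of the coordinates outside and inside of `{i, j}`. -/
noncomputable abbrev splitPair {n : ℕ} (i j : Fin n) :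
    (Fin n → ℝ) ≃ᵐ (∀ _ : {x // x ∈ ({i, j}ᶜ : Set (Fin n))}, ℝ) ×
      (∀ _ : {x // ¬ x ∈ ({i, j}ᶜ : Set (Fin n))}, ℝ) :=
  MeasurableEquiv.piEquivPiSubtypeProd (fun _ : Fin n => ℝ) (· ∈ ({i, j}ᶜ : Set (Fin n)))

/-- The points with `i`-th coordinate in `A` and `j`-th coordinate in `B`. -/
def pairBox {n : ℕ} (i j : Fin n) (A B : Set ℝ) :
    Set (∀ _ : {x // ¬ x ∈ ({i, j}ᶜ : Set (Fin n))}, ℝ) :=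
  {y | y ⟨i, by simp⟩ ∈ A ∧ y ⟨j, by simp⟩ ∈ B}

theorem measurableSet_pairBox {n : ℕ} (i j : Fin n) {A B : Set ℝ} (hA : MeasurableSet A)
    (hB : MeasurableSet B) : MeasurableSet (pairBox i j A B) :=
  MeasurableSet.inter
    (measurableSet_preimage (f := fun y : (∀ _ : {x // ¬ x ∈ ({i, j}ᶜ : Set (Fin n))}, ℝ) =>
      y ⟨i, by simp⟩) (by fun_prop) hA)
    (measurableSet_preimage (f := fun y : (∀ _ : {x // ¬ x ∈ ({i, j}ᶜ : Set (Fin n))}, ℝ) =>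
      y ⟨j, by simp⟩) (by fun_prop) hB)

/-- The kernels are the conditional distributions of the two coordinates given the rest; conditional
independence makes the joint conditional distribution their product. -/
theorem CondIndepGivenRest.exists_kernel {n : ℕ} {μ : Measure (Fin n → ℝ)} [IsFiniteMeasure μ]
    {i j : Fin n} (h : CondIndepGivenRest μ i j) :
    ∃ κ η : Kernel (∀ _ : {x // x ∈ ({i, j}ᶜ : Set (Fin n))}, ℝ) ℝ, IsMarkovKernel κ ∧
      IsMarkovKernel η ∧ ∀ A B C, MeasurableSet A → MeasurableSet B → MeasurableSet C →
        μ ((splitPair i j) ⁻¹' (C ×ˢ pairBox i j A B)) =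
          ∫⁻ r in C, κ r A * η r B ∂(μ.map fun x => (splitPair i j x).1) := by
  set k : (Fin n → ℝ) → (∀ _ : {x // x ∈ ({i, j}ᶜ : Set (Fin n))}, ℝ) :=
    fun x => (splitPair i j x).1 with hk
  have hkm : Measurable k := by fun_prop
  have h' : CondIndepFun _ hkm.comap_le (fun z : Fin n → ℝ => z i) (fun z => z j) μ :=
    (condIndepFun_congr_measurableSpace (cylinderEvents_eq_comap_restrict _) _ _).1 h
  rw [condIndepFun_iff_map_prod_eq_prod_condDistrib_prod_condDistrib (by fun_prop)
    (by fun_prop) hkm] at h'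
  refine ⟨condDistrib (fun z : Fin n → ℝ => z i) k μ, condDistrib (fun z : Fin n → ℝ => z j) k μ,
    inferInstance, inferInstance, fun A B C hA hB hC => ?_⟩
  have := congrArg (fun ν => ν (C ×ˢ (A ×ˢ B))) h'
  rw [Measure.map_apply (by fun_prop) (by measurability), ← Measure.compProd_eq_comp_prod,
    Measure.compProd_apply_prod hC (by measurability)] at this
  simp only [Kernel.prod_apply_prod] at this
  rw [← this]
  rfl

/-- On almost every fibre the mass of a box is a product (marginal density) · `κ r A` · `η r B`.
Both sides are then the same product of six factors, and the kernels disappear from the statement.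
-/
theorem CondIndepGivenRest.lintegral_pairBox_mul {n : ℕ} {μ : Measure (Fin n → ℝ)}
    [IsFiniteMeasure μ] {i j : Fin n} (h : CondIndepGivenRest μ i j)
    {Q : (Fin n → ℝ) → ENNReal} (hQ : Measurable Q) (hμ : μ = volume.withDensity Q)
    {A A' B B' : Set ℝ} (hA : MeasurableSet A) (hA' : MeasurableSet A') (hB : MeasurableSet B)
    (hB' : MeasurableSet B') :
    ∀ᵐ r, (∫⁻ y in pairBox i j A B, Q ((splitPair i j).symm (r, y))) *
        (∫⁻ y in pairBox i j A' B', Q ((splitPair i j).symm (r, y))) =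
      (∫⁻ y in pairBox i j A' B, Q ((splitPair i j).symm (r, y))) *
        (∫⁻ y in pairBox i j A B', Q ((splitPair i j).symm (r, y))) := by
  obtain ⟨κ, η, _, _, hκ⟩ := h.exists_kernel
  have hQ' : Measurable fun q => Q ((splitPair i j).symm q) := hQ.comp (splitPair i j).symm.measurable
  have hint : ∀ A : Set _, MeasurableSet A → Measurable fun r =>
      ∫⁻ y in A, Q ((splitPair i j).symm (r, y)) := fun A _ => hQ'.lintegral_prod_right'
  have hprod : ∀ C D, MeasurableSet C → MeasurableSet D →
      μ ((splitPair i j) ⁻¹' (C ×ˢ D)) =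
        ∫⁻ r in C, ∫⁻ y in D, Q ((splitPair i j).symm (r, y)) := by
    intro C D hC hD
    rw [hμ, withDensity_apply _ ((splitPair i j).measurable (hC.prod hD)),
      ← (volume_preserving_piEquivPiSubtypeProd (fun _ : Fin n => ℝ) _).symm
        |>.setLIntegral_comp_preimage_emb (splitPair i j).symm.measurableEmbedding]
    rw [← preimage_comp]
    simp only [MeasurableEquiv.self_comp_symm, preimage_id]
    rw [Measure.volume_eq_prod, ← Measure.prod_restrict, lintegral_prod _ hQ'.aemeasurable]
  have hmap : μ.map (fun x => (splitPair i j x).1) =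
      volume.withDensity fun r => ∫⁻ y, Q ((splitPair i j).symm (r, y)) := by
    ext C hC
    rw [Measure.map_apply (by fun_prop) hC, withDensity_apply _ hC]
    simpa [prod_univ, preimage_preimage] using hprod C univ hC .univ
  -- Both sides have the same integral over every measurable set `C` of values `r`.
  have key : ∀ A B, MeasurableSet A → MeasurableSet B → ∀ᵐ r,
      ∫⁻ y in pairBox i j A B, Q ((splitPair i j).symm (r, y)) =
        (∫⁻ y, Q ((splitPair i j).symm (r, y))) * (κ r A * η r B) := by
    intro A B hA hB
    have hAB := measurableSet_pairBox i j hA hB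
    have hm : Measurable fun r => κ r A * η r B :=
      (κ.measurable_coe hA).mul (η.measurable_coe hB)
    have hq : Measurable fun r => ∫⁻ y, Q ((splitPair i j).symm (r, y)) :=
      hQ'.lintegral_prod_right'
    refine ae_eq_of_forall_setLIntegral_eq_of_sigmaFinite (hint _ hAB) (hq.mul hm) ?_
    intro C hC _
    rw [← hprod C _ hC hAB, hκ A B C hA hB hC, hmap]
    exact setLIntegral_withDensity_eq_setLIntegral_mul _ hq hm hC
  filter_upwards [key A B hA hB, key A' B' hA' hB', key A' B hA' hB, key A B' hA hB'] with r h₁ h₂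
    h₃ h₄
  rw [h₁, h₂, h₃, h₄]
  ring

/-- At a continuity point the averages are squeezed between constants close to `Q y`; unlike
Lebesgue differentiation, no exceptional null set of points arises. -/
theorem tendsto_lintegral_closedBall_div {X : Type*} [PseudoMetricSpace X] [MeasurableSpace X]
    [OpensMeasurableSpace X] [ProperSpace X] {ν : Measure X} [ν.IsOpenPosMeasure]
    [IsFiniteMeasureOnCompacts ν] {Q : X → ENNReal} {y : X} (hQ : ContinuousAt Q y)
    {ε : ℕ → ℝ} (hpos : ∀ m, 0 < ε m) (hε : Tendsto ε atTop (𝓝 0)) :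
    Tendsto (fun m => (∫⁻ x in Metric.closedBall y (ε m), Q x ∂ν) /
      ν (Metric.closedBall y (ε m))) atTop (𝓝 (Q y)) := by
  have h0 : ∀ m, ν (Metric.closedBall y (ε m)) ≠ 0 := fun m =>
    (Metric.measure_closedBall_pos ν y (hpos m)).ne'
  have hT : ∀ m, ν (Metric.closedBall y (ε m)) ≠ ⊤ := fun m =>
    (isCompact_closedBall y (ε m)).measure_lt_top.ne
  have hmem : ∀ P : X → Prop, (∀ᶠ x in 𝓝 y, P x) →
      ∀ᶠ m in atTop, ∀ x ∈ Metric.closedBall y (ε m), P x := by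
    intro P hP
    obtain ⟨δ, hδ, hball⟩ := Metric.nhds_basis_closedBall.eventually_iff.1 hP
    filter_upwards [hε.eventually (eventually_le_nhds hδ)] with m hm x hx
    exact hball (Metric.closedBall_subset_closedBall hm hx)
  refine tendsto_order.2 ⟨fun a ha => ?_, fun b hb => ?_⟩
  · obtain ⟨c, hac, hc⟩ := exists_between ha
    filter_upwards [hmem _ (hQ.eventually (eventually_ge_nhds hc))] with m hm
    refine hac.trans_le ?_
    rw [ENNReal.le_div_iff_mul_le (.inl (h0 m)) (.inl (hT m)), ← setLIntegral_const]
    exact setLIntegral_mono' Metric.isClosed_closedBall.measurableSet hm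
  · obtain ⟨c, hc, hcb⟩ := exists_between hb
    filter_upwards [hmem _ (hQ.eventually (eventually_le_nhds hc))] with m hm
    refine lt_of_le_of_lt ?_ hcb
    rw [ENNReal.div_le_iff (h0 m) (hT m), ← setLIntegral_const]
    exact setLIntegral_mono' Metric.isClosed_closedBall.measurableSet hm

theorem continuous_splitPair_symm {n : ℕ} (i j : Fin n) : Continuous (splitPair i j).symm := by
  classical
  exact (Homeomorph.piEquivPiSubtypeProd (· ∈ ({i, j}ᶜ : Set (Fin n)))
    (fun _ => ℝ)).symm.continuous

/-- Balls of the sup metric are boxes, so box masses can be read as ball averages. -/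
theorem pairBox_closedBall {n : ℕ} (i j : Fin n)
    (y : ∀ _ : {x // ¬ x ∈ ({i, j}ᶜ : Set (Fin n))}, ℝ) {ε : ℝ} (hε : 0 ≤ ε) :
    pairBox i j (Metric.closedBall (y ⟨i, by simp⟩) ε) (Metric.closedBall (y ⟨j, by simp⟩) ε) =
      Metric.closedBall y ε := by
  ext z
  simp only [pairBox, mem_ofPred_eq, Metric.mem_closedBall, dist_pi_le_iff hε]
  refine ⟨fun h b => ?_, fun h => ⟨h _, h _⟩⟩
  obtain ⟨b, hb⟩ := b
  have : b = i ∨ b = j := by simpa [or_iff_not_imp_left] using hb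
  rcases this with rfl | rfl
  exacts [h.1, h.2]

/-- A density of a law with conditionally independent coordinates factorizes where it is
continuous. -/
theorem CondIndepGivenRest.density_mul_density {n : ℕ} {μ : Measure (Fin n → ℝ)}
    [IsFiniteMeasure μ] {i j : Fin n} (h : CondIndepGivenRest μ i j) (hij : i ≠ j)
    {Q : (Fin n → ℝ) → ENNReal} (hQ : Measurable Q) (hμ : μ = volume.withDensity Q)
    {W : Set (Fin n → ℝ)} (hW : IsOpen W) (hQW : ContinuousOn Q W) (hfin : ∀ x ∈ W, Q x ≠ ⊤)
    {x : Fin n → ℝ} {a b : ℝ} (hx : x ∈ W) (hxa : x + Pi.single i a ∈ W)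
    (hxb : x + Pi.single j b ∈ W) (hxab : x + Pi.single i a + Pi.single j b ∈ W) :
    Q x * Q (x + Pi.single i a + Pi.single j b) =
      Q (x + Pi.single i a) * Q (x + Pi.single j b) := by
  set E := splitPair i j
  have hsplit : ∀ z, (∀ m, m ≠ i → m ≠ j → z m = x m) → E.symm ((E x).1, (E z).2) = z := by
    intro z hz
    rw [MeasurableEquiv.symm_apply_eq]
    refine Prod.ext (funext fun m => ?_) rfl
    obtain ⟨m, hm⟩ := m
    have : ¬ (m = i ∨ m = j) := by simpa using hm
    exact (hz m (fun h => this (.inl h)) fun h => this (.inr h)).symm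
  set x₂ := x + Pi.single i a
  set x₃ := x + Pi.single j b
  set x₄ := x + Pi.single i a + Pi.single j b
  have e₁ := hsplit x fun m _ _ => rfl
  have e₂ := hsplit x₂ fun m h₁ h₂ => by simp [x₂, h₁]
  have e₃ := hsplit x₃ fun m h₁ h₂ => by simp [x₃, h₂]
  have e₄ := hsplit x₄ fun m h₁ h₂ => by simp [x₄, h₁, h₂]
  have hcont : Continuous fun q => E.symm q := continuous_splitPair_symm i j
  have hc : ∀ y, Continuous fun r => E.symm (r, y) := fun y => hcont.comp (by fun_prop)
  have hc' : ∀ r, Continuous fun y => E.symm (r, y) := fun r => hcont.comp (by fun_prop)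
  -- The four corners keep their `i, j` coordinates while the remaining ones, `r`, vary; `O` is the
  -- set of `r` for which all four stay in `W`.
  let O : Set (∀ _ : {x // x ∈ ({i, j}ᶜ : Set (Fin n))}, ℝ) :=
    {r | E.symm (r, (E x).2) ∈ W} ∩ {r | E.symm (r, (E x₂).2) ∈ W} ∩
      ({r | E.symm (r, (E x₃).2) ∈ W} ∩ {r | E.symm (r, (E x₄).2) ∈ W})
  have hO : IsOpen O := ((hW.preimage (hc _)).inter (hW.preimage (hc _))).inter
    ((hW.preimage (hc _)).inter (hW.preimage (hc _)))
  have hfour : ∀ᵐ r, r ∈ O →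
      Q (E.symm (r, (E x).2)) * Q (E.symm (r, (E x₄).2)) =
        Q (E.symm (r, (E x₂).2)) * Q (E.symm (r, (E x₃).2)) := by
    let ε : ℕ → ℝ := fun m => 1 / ((m : ℝ) + 1)
    have hpos : ∀ m, 0 < ε m := fun m => Nat.one_div_pos_of_nat
    have hε : Tendsto ε atTop (𝓝 0) := tendsto_one_div_add_atTop_nhds_zero_nat
    -- Countably many radii give one null set of `r`, outside which the radius can tend to zero.
    have hae := ae_all_iff.2 fun m : ℕ => h.lintegral_pairBox_mul hQ hμ
      (A := Metric.closedBall (x i) (ε m)) (A' := Metric.closedBall (x₄ i) (ε m))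
      (B := Metric.closedBall (x j) (ε m)) (B' := Metric.closedBall (x₄ j) (ε m))
      Metric.isClosed_closedBall.measurableSet Metric.isClosed_closedBall.measurableSet
      Metric.isClosed_closedBall.measurableSet Metric.isClosed_closedBall.measurableSet
    filter_upwards [hae] with r hr hrO
    have hbox : ∀ z z' : Fin n → ℝ, ∀ m, z i = z' i →
        pairBox i j (Metric.closedBall (z' i) (ε m)) (Metric.closedBall (z j) (ε m)) =
          Metric.closedBall (E z).2 (ε m) := fun z z' m hz => by
      rw [← hz]; exact pairBox_closedBall i j (E z).2 (hpos m).le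
    have hvol : ∀ (m : ℕ) (y : ∀ _ : {x // ¬ x ∈ ({i, j}ᶜ : Set (Fin n))}, ℝ),
        volume (Metric.closedBall y (ε m)) =
        volume (Metric.closedBall (E x).2 (ε m)) := fun m y => by
      rw [Real.volume_pi_closedBall _ (hpos m).le, Real.volume_pi_closedBall _ (hpos m).le]
    have hlim : ∀ z, E.symm (r, (E z).2) ∈ W → Tendsto (fun m =>
        (∫⁻ y in Metric.closedBall (E z).2 (ε m), Q (E.symm (r, y))) /
          volume (Metric.closedBall (E x).2 (ε m))) atTop (𝓝 (Q (E.symm (r, (E z).2)))) := by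
      intro z hz
      have := tendsto_lintegral_closedBall_div (ν := volume)
        (Q := fun y => Q (E.symm (r, y))) (y := (E z).2)
        (ContinuousAt.comp (hQW.continuousAt (hW.mem_nhds hz)) (hc' r).continuousAt) hpos hε
      simpa only [hvol] using this
    obtain ⟨⟨h₁, h₂⟩, h₃, h₄⟩ := hrO
    have l₁ := ENNReal.Tendsto.mul (hlim x h₁) (.inr (hfin _ h₄)) (hlim x₄ h₄) (.inr (hfin _ h₁))
    have l₂ := ENNReal.Tendsto.mul (hlim x₂ h₂) (.inr (hfin _ h₃)) (hlim x₃ h₃) (.inr (hfin _ h₂))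
    refine tendsto_nhds_unique l₁ (l₂.congr fun m => ?_)
    have hm := hr m
    have b₁ := hbox x x m rfl
    have b₄ := hbox x₄ x₄ m rfl
    have b₂ := hbox x₂ x₄ m (by simp [x₄, x₂, hij])
    have b₃ := hbox x₃ x m (by simp [x₃, hij])
    have k₂ : x₂ j = x j := by simp [x₂, hij.symm]
    have k₃ : x₃ j = x₄ j := by simp [x₃, x₄, hij.symm]
    rw [k₂] at b₂
    rw [k₃] at b₃
    rw [b₁, b₂, b₃, b₄] at hm
    simp only [div_eq_mul_inv]
    rw [mul_mul_mul_comm, ← hm, mul_mul_mul_comm]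
  have hQc : ∀ y, (∀ r ∈ O, E.symm (r, y) ∈ W) → ContinuousOn (fun r => Q (E.symm (r, y))) O :=
    fun y hy => hQW.comp (hc y).continuousOn hy
  have c₁ := hQc (E x).2 fun r hr => hr.1.1
  have c₂ := hQc (E x₂).2 fun r hr => hr.1.2
  have c₃ := hQc (E x₃).2 fun r hr => hr.2.1
  have c₄ := hQc (E x₄).2 fun r hr => hr.2.2
  -- Continuity in `r` removes the null set, so the identity holds at the given point itself.
  have heq := Measure.eqOn_open_of_ae_eq (μ := volume) ((ae_restrict_iff' hO.measurableSet).2 hfour) hO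
    (fun r hr => ENNReal.Tendsto.mul (c₁ r hr) (.inr (hfin _ hr.2.2)) (c₄ r hr)
      (.inr (hfin _ hr.1.1)))
    (fun r hr => ENNReal.Tendsto.mul (c₂ r hr) (.inr (hfin _ hr.2.1)) (c₃ r hr)
      (.inr (hfin _ hr.1.2)))
  have h0 : (E x).1 ∈ O := by
    simp only [O, mem_inter_iff, mem_ofPred_eq, e₁, e₂, e₃, e₄]
    exact ⟨⟨hx, hxa⟩, hxb, hxab⟩
  have := heq h0
  simpa only [e₁, e₂, e₃, e₄] using this

/-! ### Images of embeddings and local inverses of `C²` diffeomorphisms onto their images. -/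

/-- Near `f x` the range lies in the image of a compact neighbourhood of `x`, which is closed. -/
theorem Topology.IsEmbedding.isLocallyClosed_range {X Y : Type*} [TopologicalSpace X]
    [TopologicalSpace Y] [LocallyCompactSpace X] [T2Space Y] {f : X → Y}
    (hf : Topology.IsEmbedding f) : IsLocallyClosed (range f) := by
  refine ((isLocallyClosed_tfae (range f)).out 0 3).2 ?_
  rintro _ ⟨x, rfl⟩
  obtain ⟨K, hK, hxK⟩ := exists_compact_mem_nhds x
  obtain ⟨U', hU', hUK⟩ := (hf.isInducing.nhds_eq_comap x ▸ hxK : K ∈ comap f (𝓝 (f x)))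
  obtain ⟨U, hUU', hU, hxU⟩ := mem_nhds_iff.1 hU'
  refine ⟨U, hxU, hU, hU.inter_closure.trans ?_⟩
  have : U ∩ range f ⊆ f '' K := by
    rintro _ ⟨hy, z, rfl⟩
    exact ⟨z, hUK (hUU' hy), rfl⟩
  exact (closure_minimal this (hK.image hf.continuous).isClosed).trans (image_subset_range _ _)

theorem IsLocallyClosed.isOpen_of_dense {X : Type*} [TopologicalSpace X] {s : Set X}
    (hs : IsLocallyClosed s) (hd : Dense s) : IsOpen s := by
  have := isLocallyClosed_iff_isOpen_coborder.1 hs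
  rwa [coborder_eq_union_closure_compl, hd.closure_eq, compl_univ, union_empty] at this

namespace IsC2DiffeoOntoImage

variable {n m d : ℕ} {g : (Fin n → ℝ) → (Fin d → ℝ)}

/-- Composing `g` with a linear left inverse of its derivative at `z` gives a map with identity
derivative there, to which the inverse function theorem applies. -/
theorem exists_leftInverse (hg : IsC2DiffeoOntoImage g) (z : Fin n → ℝ) :
    ∃ Φ : (Fin d → ℝ) → (Fin n → ℝ), ContDiffAt ℝ 2 Φ (g z) ∧ ∀ᶠ y in 𝓝 z, Φ (g y) = y := by
  obtain ⟨P, hP⟩ := (fderiv ℝ g z : (Fin n → ℝ) →ₗ[ℝ] (Fin d → ℝ)).exists_leftInverse_of_injective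
    (LinearMap.ker_eq_bot.2 (hg.injective_fderiv z))
  set P' : (Fin d → ℝ) →L[ℝ] (Fin n → ℝ) := LinearMap.toContinuousLinearMap P
  have hc : ContDiffAt ℝ 2 (P' ∘ g) z := P'.contDiff.contDiffAt.comp z hg.contDiff.contDiffAt
  have hd : HasFDerivAt (P' ∘ g) ((ContinuousLinearEquiv.refl ℝ (Fin n → ℝ) :
      (Fin n → ℝ) ≃L[ℝ] (Fin n → ℝ)) : (Fin n → ℝ) →L[ℝ] (Fin n → ℝ)) z := by
    have h₁ := P'.hasFDerivAt.comp z
      ((hg.contDiff.differentiable two_ne_zero).differentiableAt (x := z)).hasFDerivAt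
    have h₂ : P'.comp (fderiv ℝ g z) = ContinuousLinearMap.id ℝ _ := by
      ext1 w
      exact LinearMap.congr_fun hP w
    rw [h₂] at h₁
    exact h₁
  refine ⟨hc.localInverse hd two_ne_zero ∘ P', ?_, ?_⟩
  · exact ContDiffAt.comp (g z) (hc.to_localInverse hd two_ne_zero) P'.contDiff.contDiffAt
  · exact (hc.hasStrictFDerivAt' hd two_ne_zero).eventually_left_inverse

/-- Locally `h = Φ ∘ f` with `Φ` a `C²` local left inverse of `g`. The embedding property first
makes `h` continuous, which keeps its values where `Φ` inverts `g`. -/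
theorem contDiffWithinAt_of_comp (hg : IsC2DiffeoOntoImage g) {f : (Fin m → ℝ) → (Fin d → ℝ)}
    {h : (Fin m → ℝ) → (Fin n → ℝ)} {s : Set (Fin m → ℝ)} (hf : ContDiff ℝ 2 f)
    (hs : ∀ x ∈ s, g (h x) = f x) {x : Fin m → ℝ} (hx : x ∈ s) : ContDiffWithinAt ℝ 2 h s x := by
  have hcont : ContinuousOn h s :=
    hg.isEmbedding.isInducing.continuousOn_iff.2 (hf.continuous.continuousOn.congr hs)
  obtain ⟨Φ, hΦ, hinv⟩ := hg.exists_leftInverse (h x)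
  have : ContDiffWithinAt ℝ 2 (Φ ∘ f) s x :=
    ContDiffAt.comp_contDiffWithinAt x (hs x hx ▸ hΦ) hf.contDiffAt.contDiffWithinAt
  refine this.congr_of_eventuallyEq_of_mem ?_ hx
  filter_upwards [(hcont x hx).eventually hinv, self_mem_nhdsWithin] with y hy hys
  rw [Function.comp_apply, ← hs y hys, hy]

theorem injective_fderiv_of_comp (hg : IsC2DiffeoOntoImage g) {f : (Fin m → ℝ) → (Fin d → ℝ)}
    {h : (Fin m → ℝ) → (Fin n → ℝ)} {s : Set (Fin m → ℝ)} (hf : IsC2DiffeoOntoImage f)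
    (hopen : IsOpen s) (hs : ∀ x ∈ s, g (h x) = f x) {x : Fin m → ℝ} (hx : x ∈ s) :
    Function.Injective (fderiv ℝ h x) := by
  have hh : DifferentiableAt ℝ h x := ((hg.contDiffWithinAt_of_comp hf.contDiff hs hx).contDiffAt
    (hopen.mem_nhds hx)).differentiableAt two_ne_zero
  have hgd : DifferentiableAt ℝ g (h x) := (hg.contDiff.differentiable two_ne_zero) _
  have heq : f =ᶠ[𝓝 x] g ∘ h := by
    filter_upwards [hopen.mem_nhds hx] with y hy using (hs y hy).symm
  have hinj := hf.injective_fderiv x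
  rw [heq.fderiv_eq, fderiv_comp x hgd hh] at hinj
  exact Function.Injective.of_comp (f := fderiv ℝ g (h x)) hinj

end IsC2DiffeoOntoImage

theorem image_mem_nhds_of_injective_fderiv {n : ℕ} {h : (Fin n → ℝ) → (Fin n → ℝ)}
    {x : Fin n → ℝ} (hh : ContDiffAt ℝ 2 h x) (hinj : Function.Injective (fderiv ℝ h x))
    {s : Set (Fin n → ℝ)} (hs : s ∈ 𝓝 x) : h '' s ∈ 𝓝 (h x) := by
  let L : (Fin n → ℝ) ≃L[ℝ] (Fin n → ℝ) :=
    (LinearEquiv.ofInjectiveEndo (fderiv ℝ h x : (Fin n → ℝ) →ₗ[ℝ] (Fin n → ℝ))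
      hinj).toContinuousLinearEquiv
  have hL : (L : (Fin n → ℝ) →L[ℝ] (Fin n → ℝ)) = fderiv ℝ h x := by ext1 w; rfl
  have hd : HasStrictFDerivAt h (L : (Fin n → ℝ) →L[ℝ] (Fin n → ℝ)) x := by
    rw [hL]; exact hh.hasStrictFDerivAt two_ne_zero
  rw [← hd.map_nhds_eq_of_equiv]
  exact image_mem_map hs

/-! ### Calculus of first and second partial derivatives. -/

section PartialD

variable {n m : ℕ}

theorem ContDiffAt.differentiableAt_partialD {F : (Fin n → ℝ) → ℝ} {x : Fin n → ℝ}
    (hF : ContDiffAt ℝ 2 F x) (i : Fin n) : DifferentiableAt ℝ (partialD i F) x := by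
  have : ContDiffAt ℝ 1 (fderiv ℝ F) x := hF.fderiv_right (by norm_num)
  exact (this.differentiableAt one_ne_zero).clm_apply (differentiableAt_const _)

theorem hasDerivAt_partialD {F : (Fin n → ℝ) → ℝ} {x : Fin n → ℝ} (hF : DifferentiableAt ℝ F x)
    (i : Fin n) : HasDerivAt (fun t : ℝ => F (x + Pi.single i t)) (partialD i F x) 0 := by
  have h := hF.hasFDerivAt.hasLineDerivAt (Pi.single i 1)
  have : (fun t : ℝ => F (x + Pi.single i t)) = fun t => F (x + t • Pi.single i 1) := by
    funext t
    rw [← Pi.single_smul, smul_eq_mul, mul_one]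
  rw [this]
  exact h

/-- A function that is locally additive in two coordinates has no mixed second derivative. -/
theorem partialD_partialD_eq_zero {F : (Fin n → ℝ) → ℝ} {x : Fin n → ℝ} {i j : Fin n}
    (hF : ContDiffAt ℝ 2 F x)
    (h : ∀ᶠ s : ℝ × ℝ in 𝓝 (0, 0), F x + F (x + Pi.single i s.1 + Pi.single j s.2) =
      F (x + Pi.single i s.1) + F (x + Pi.single j s.2)) :
    partialD i (partialD j F) x = 0 := by
  have hdiff : ∀ᶠ y in 𝓝 x, DifferentiableAt ℝ F y :=
    (hF.eventually (by simp)).mono fun y hy => hy.differentiableAt two_ne_zero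
  have hline : Tendsto (fun a : ℝ => x + Pi.single i a) (𝓝 0) (𝓝 x) := by
    have : Continuous fun a : ℝ => x + (Pi.single i a : Fin n → ℝ) := by
      exact continuous_const.add ((continuous_single i).comp continuous_id)
    simpa using this.tendsto 0
  -- For fixed small `a`, the slices of `F` in direction `j` through `x` and through its shift by
  -- `a` in direction `i` differ by a constant.
  have hconst : ∀ᶠ a : ℝ in 𝓝 0, partialD j F (x + Pi.single i a) = partialD j F x := by
    filter_upwards [(nhds_prod_eq (x := (0 : ℝ)) (y := (0 : ℝ)) ▸ h).curry,
      hline.eventually hdiff] with a ha hda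
    have h₁ := hasDerivAt_partialD hda j
    have h₂ := ((hasDerivAt_partialD hdiff.self_of_nhds j).const_add
      (F (x + Pi.single i a))).sub_const (F x)
    refine h₁.unique (h₂.congr_of_eventuallyEq ?_)
    filter_upwards [ha] with b hb
    linarith
  exact (hasDerivAt_partialD (hF.differentiableAt_partialD j) i).unique
    ((hasDerivAt_const _ _).congr_of_eventuallyEq hconst)

theorem partialD_comp {F : (Fin n → ℝ) → ℝ} {v : (Fin m → ℝ) → (Fin n → ℝ)} {x : Fin m → ℝ}
    (hF : DifferentiableAt ℝ F (v x)) (hv : DifferentiableAt ℝ v x) (k : Fin m) :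
    partialD k (fun y => F (v y)) x =
      ∑ i, partialD i F (v x) * partialD k (fun y => v y i) x := by
  have h : fderiv ℝ (fun y => F (v y)) x = (fderiv ℝ F (v x)).comp (fderiv ℝ v x) :=
    fderiv_comp x hF hv
  have hi : ∀ i, partialD k (fun y => v y i) x = fderiv ℝ v x (Pi.single k 1) i := by
    intro i
    rw [partialD, (hasFDerivAt_pi'.1 hv.hasFDerivAt i).fderiv]
    rfl
  simp only [hi]
  rw [partialD, h, ContinuousLinearMap.comp_apply]
  conv_lhs => rw [pi_eq_sum_univ' (fderiv ℝ v x (Pi.single k 1))]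
  simp only [map_sum, map_smul, smul_eq_mul]
  refine Finset.sum_congr rfl fun i _ => ?_
  rw [mul_comm, partialD]

theorem partialD_partialD_comp {F : (Fin n → ℝ) → ℝ} {v : (Fin m → ℝ) → (Fin n → ℝ)}
    {x : Fin m → ℝ} (hF : ContDiff ℝ 2 F) (hv : ContDiffAt ℝ 2 v x) (k l : Fin m) :
    partialD k (partialD l fun y => F (v y)) x =
      ∑ i, ∑ j, partialD j (partialD i F) (v x) *
          (partialD k (fun y => v y j) x * partialD l (fun y => v y i) x) +
        ∑ i, partialD i F (v x) * partialD k (partialD l fun y => v y i) x := by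
  have hvi : ∀ i, ContDiffAt ℝ 2 (fun y => v y i) x := contDiffAt_pi.1 hv
  have hFd : Differentiable ℝ F := hF.differentiable two_ne_zero
  have heq : (partialD l fun y => F (v y)) =ᶠ[𝓝 x]
      fun y => ∑ i, partialD i F (v y) * partialD l (fun y => v y i) y := by
    filter_upwards [hv.eventually (by simp)] with y hy
    exact partialD_comp (hFd _) (hy.differentiableAt two_ne_zero) l
  have hvx : DifferentiableAt ℝ v x := hv.differentiableAt two_ne_zero
  have h₁ : ∀ i, DifferentiableAt ℝ (partialD i F) (v x) := fun i =>
    hF.contDiffAt.differentiableAt_partialD i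
  have h₂ : ∀ i, DifferentiableAt ℝ (fun y => partialD i F (v y)) x := fun i =>
    (h₁ i).comp x hvx
  have h₃ : ∀ i, DifferentiableAt ℝ (fun y => partialD l (fun y => v y i) y) x := fun i =>
    (hvi i).differentiableAt_partialD l
  rw [partialD, heq.fderiv_eq, fderiv_fun_sum fun i _ => (h₂ i).fun_mul (h₃ i), ← Finset.sum_add_distrib,
    sum_apply]
  refine Finset.sum_congr rfl fun i _ => ?_
  rw [fderiv_fun_mul (h₂ i) (h₃ i)]
  have := partialD_comp (h₁ i) hvx k
  rw [partialD] at this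
  simp only [add_apply, smul_apply, this, smul_eq_mul]
  rw [add_comm, Finset.mul_sum]
  congr 1
  refine Finset.sum_congr rfl fun j _ => by ring

theorem partialD_partialD_comm {F : (Fin n → ℝ) → ℝ} {x : Fin n → ℝ} (hF : ContDiffAt ℝ 2 F x)
    (i j : Fin n) : partialD i (partialD j F) x = partialD j (partialD i F) x := by
  have hd : DifferentiableAt ℝ (fderiv ℝ F) x :=
    ContDiffAt.differentiableAt (n := 1) (hF.fderiv_right (by norm_num)) one_ne_zero
  have h : ∀ i j, partialD i (partialD j F) x =
      fderiv ℝ (fderiv ℝ F) x (Pi.single i 1) (Pi.single j 1) := by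
    intro i j
    have : partialD j F = fun y => fderiv ℝ F y (Pi.single j 1) := rfl
    rw [this, partialD, fderiv_clm_apply hd (differentiableAt_const _)]
    simp
  rw [h, h, hF.isSymmSndFDerivAt (by simp)]

theorem partialD_fun_sub {F G : (Fin n → ℝ) → ℝ} {x : Fin n → ℝ} (hF : DifferentiableAt ℝ F x)
    (hG : DifferentiableAt ℝ G x) (i : Fin n) :
    partialD i (fun y => F y - G y) x = partialD i F x - partialD i G x := by
  rw [partialD, fderiv_fun_sub hF hG]
  rfl

theorem partialD_partialD_fun_sub {F G : (Fin n → ℝ) → ℝ} (hF : ContDiff ℝ 2 F)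
    (hG : ContDiff ℝ 2 G) (x : Fin n → ℝ) (i j : Fin n) :
    partialD i (partialD j fun y => F y - G y) x =
      partialD i (partialD j F) x - partialD i (partialD j G) x := by
  have : (partialD j fun y => F y - G y) = fun y => partialD j F y - partialD j G y :=
    funext fun y => partialD_fun_sub (hF.differentiable two_ne_zero _)
      (hG.differentiable two_ne_zero _) j
  rw [this]
  exact partialD_fun_sub (hF.contDiffAt.differentiableAt_partialD j)
    (hG.contDiffAt.differentiableAt_partialD j) i

end PartialD

/-! ### Local additivity of log-densities. -/

/-- The logarithm of a density of a law with conditionally independent coordinates is locally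
additive in these coordinates. -/
theorem CondIndepGivenRest.log_density_add {n : ℕ} {μ : Measure (Fin n → ℝ)}
    [IsFiniteMeasure μ] {i j : Fin n} (h : CondIndepGivenRest μ i j) (hij : i ≠ j)
    {Q : (Fin n → ℝ) → ENNReal} (hQ : Measurable Q) (hμ : μ = volume.withDensity Q)
    {W : Set (Fin n → ℝ)} (hW : IsOpen W) {q : (Fin n → ℝ) → ℝ}
    (hQq : ∀ x ∈ W, Q x = ENNReal.ofReal (q x)) (hq : ContinuousOn q W) (hpos : ∀ x ∈ W, 0 < q x)
    {x : Fin n → ℝ} (hx : x ∈ W) :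
    ∀ᶠ s : ℝ × ℝ in 𝓝 (0, 0),
      Real.log (q x) + Real.log (q (x + Pi.single i s.1 + Pi.single j s.2)) =
        Real.log (q (x + Pi.single i s.1)) + Real.log (q (x + Pi.single j s.2)) := by
  have hQW : ContinuousOn Q W := (ENNReal.continuous_ofReal.comp_continuousOn hq).congr hQq
  have hev : ∀ f : ℝ × ℝ → (Fin n → ℝ), Continuous f → f (0, 0) = x → ∀ᶠ s in 𝓝 (0, 0), f s ∈ W :=
    fun f hf h0 => hf.continuousAt.eventually_mem (hW.mem_nhds (h0 ▸ hx))
  have hi : Continuous fun s : ℝ × ℝ => (Pi.single i s.1 : Fin n → ℝ) :=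
    (continuous_single i).comp continuous_fst
  have hj : Continuous fun s : ℝ × ℝ => (Pi.single j s.2 : Fin n → ℝ) :=
    (continuous_single j).comp continuous_snd
  filter_upwards [hev (fun s => x + Pi.single i s.1 + Pi.single j s.2) (by fun_prop) (by simp),
    hev (fun s => x + Pi.single i s.1) (by fun_prop) (by simp),
    hev (fun s => x + Pi.single j s.2) (by fun_prop) (by simp)] with s hab ha hb
  have := h.density_mul_density hij hQ hμ hW hQW (fun y hy => by simp [hQq y hy]) hx ha hb hab
  rw [hQq _ hx, hQq _ ha, hQq _ hb, hQq _ hab, ← ENNReal.ofReal_mul (hpos _ hx).le,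
    ← ENNReal.ofReal_mul (hpos _ ha).le, ENNReal.ofReal_eq_ofReal_iff
      (mul_pos (hpos _ hx) (hpos _ hab)).le (mul_pos (hpos _ ha) (hpos _ hb)).le] at this
  rw [← Real.log_mul (hpos _ hx).ne' (hpos _ hab).ne', this,
    Real.log_mul (hpos _ ha).ne' (hpos _ hb).ne']

/-! ### The change of latent coordinates `v` and the law of `Ẑ`. -/

section LatentMap

variable {n d : ℕ} {Par Par' : Fin n → Type*} {Dom : Type*}
  {M : GenerativeModel n d Par Dom} {N : GenerativeModel n d Par' Dom}

theorem g_latentMap {x : Fin n → ℝ} (hx : x ∈ latentDomain M N) :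
    M.g (latentMap M N x) = N.g x :=
  Function.invFun_eq hx

theorem injOn_latentMap : InjOn (latentMap M N) (latentDomain M N) := fun x hx y hy h =>
  N.diffeo.isEmbedding.injective (by rw [← g_latentMap hx, ← g_latentMap hy, h])

theorem latentMap_mem {x : Fin n → ℝ} (hx : x ∈ latentDomain M N) :
    latentMap M N x ∈ latentDomain N M :=
  ⟨x, (g_latentMap hx).symm⟩

theorem latentMap_latentMap {x : Fin n → ℝ} (hx : x ∈ latentDomain M N) :
    latentMap N M (latentMap M N x) = x :=
  N.diffeo.isEmbedding.injective (by rw [g_latentMap (latentMap_mem hx), g_latentMap hx])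

theorem GenerativeModel.measurableEmbedding_g (M : GenerativeModel n d Par Dom) :
    MeasurableEmbedding M.g :=
  M.diffeo.contDiff.continuous.measurableEmbedding M.diffeo.isEmbedding.injective

theorem latentLaw_eq_latentLaw_image (hmatch : ∀ u, M.observedLaw u = N.observedLaw u) (u : Dom)
    {S : Set (Fin n → ℝ)} (hS : MeasurableSet S) :
    N.latentLaw u S = M.latentLaw u (latentMap M N '' (S ∩ latentDomain M N)) := by
  have hM := M.measurableEmbedding_g
  have hN := N.measurableEmbedding_g
  have h := congrArg (fun μ => μ (N.g '' S)) (hmatch u)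
  have hNS := hN.measurableSet_image.2 hS
  simp only [GenerativeModel.observedLaw] at h
  rw [Measure.map_apply hM.measurable hNS, Measure.map_apply hN.measurable hNS,
    preimage_image_eq _ hN.injective] at h
  rw [← h]
  congr 1
  ext z
  constructor
  · rintro ⟨x, hx, hxz⟩
    have hxW : x ∈ latentDomain M N := ⟨z, hxz.symm⟩
    exact ⟨x, ⟨hx, hxW⟩, M.diffeo.isEmbedding.injective (by rw [g_latentMap hxW, hxz])⟩
  · rintro ⟨x, ⟨hx, hxW⟩, rfl⟩
    exact ⟨x, hx, (g_latentMap hxW).symm⟩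

theorem ae_mem_latentDomain (hmatch : ∀ u, M.observedLaw u = N.observedLaw u) (u : Dom) :
    ∀ᵐ x ∂(N.latentLaw u), x ∈ latentDomain M N := by
  have hM := M.measurableEmbedding_g
  have hN := N.measurableEmbedding_g
  have hr : MeasurableSet (range M.g) := hM.measurableSet_range
  have h := congrArg (fun μ => μ (range M.g)) (hmatch u)
  simp only [GenerativeModel.observedLaw] at h
  rw [Measure.map_apply hM.measurable hr, Measure.map_apply hN.measurable hr, preimage_range,
    measure_univ] at h
  exact (prob_compl_eq_zero_iff (hN.measurable hr)).2 h.symm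

/-- The reversed domain is treated first because positivity of the density is known only for `M`:
there, full measure implies density of the set, and a dense locally closed set is open. -/
theorem isOpen_latentDomain_swap {p : Dom → (Fin n → ℝ) → ℝ} (hA1 : SmoothPositiveDensity M p)
    (hmatch : ∀ u, M.observedLaw u = N.observedLaw u) (u : Dom) :
    IsOpen (latentDomain N M) := by
  have hac : (volume : Measure (Fin n → ℝ)) ≪ M.latentLaw u := by
    rw [(hA1 u).1]
    exact withDensity_absolutelyContinuous' (ENNReal.measurable_ofReal.comp
      (hA1 u).2.1.continuous.measurable).aemeasurable
      (ae_of_all _ fun z => by simpa using (hA1 u).2.2 z)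
  have hd : Dense (latentDomain N M) :=
    Measure.dense_of_ae (hac.ae_le (ae_mem_latentDomain (fun u => (hmatch u).symm) u))
  exact (N.diffeo.isEmbedding.isLocallyClosed_range.preimage
    M.diffeo.contDiff.continuous).isOpen_of_dense hd

theorem contDiffOn_latentMap : ContDiffOn ℝ 2 (latentMap M N) (latentDomain M N) := fun _ hx =>
  M.diffeo.contDiffWithinAt_of_comp N.diffeo.contDiff (fun _ => g_latentMap) hx

/-- This set is the image of the open set `latentDomain N M` under `latentMap N M`, whose derivative
is injective there, so the inverse function theorem applies. -/
theorem isOpen_latentDomain {p : Dom → (Fin n → ℝ) → ℝ} (hA1 : SmoothPositiveDensity M p)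
    (hmatch : ∀ u, M.observedLaw u = N.observedLaw u) (u : Dom) :
    IsOpen (latentDomain M N) := by
  have hV := isOpen_latentDomain_swap hA1 hmatch u
  refine isOpen_iff_mem_nhds.2 fun x hx => ?_
  have hz := latentMap_mem hx
  have := image_mem_nhds_of_injective_fderiv (contDiffOn_latentMap.contDiffAt (hV.mem_nhds hz))
    (N.diffeo.injective_fderiv_of_comp M.diffeo hV (fun _ => g_latentMap) hz) (hV.mem_nhds hz)
  rw [latentMap_latentMap hx] at this
  refine mem_of_superset this ?_
  rintro _ ⟨z, hz, rfl⟩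
  exact latentMap_mem hz

theorem continuousOn_det_fderiv_latentMap (hW : IsOpen (latentDomain M N)) :
    ContinuousOn (fun x => |(fderiv ℝ (latentMap M N) x).det|) (latentDomain M N) :=
  (ContinuousLinearMap.continuous_det.comp_continuousOn
    (contDiffOn_latentMap.continuousOn_fderiv_of_isOpen hW (by norm_num))).abs

theorem det_fderiv_latentMap_pos (hW : IsOpen (latentDomain M N)) {x : Fin n → ℝ}
    (hx : x ∈ latentDomain M N) : 0 < |(fderiv ℝ (latentMap M N) x).det| := by
  have hinj := M.diffeo.injective_fderiv_of_comp N.diffeo hW (fun _ => g_latentMap) hx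
  have := LinearMap.bot_lt_ker_of_det_eq_zero
    (f := (fderiv ℝ (latentMap M N) x : (Fin n → ℝ) →ₗ[ℝ] (Fin n → ℝ)))
  refine abs_pos.2 fun h => (this h).ne' (LinearMap.ker_eq_bot.2 hinj)

open Classical in
/-- Change of variables: a density of the law of the estimated latent vector. -/
theorem latentLaw_eq_withDensity {p : Dom → (Fin n → ℝ) → ℝ} (hA1 : SmoothPositiveDensity M p)
    (hmatch : ∀ u, M.observedLaw u = N.observedLaw u) (u : Dom) :
    ∃ Q : (Fin n → ℝ) → ENNReal, Measurable Q ∧ N.latentLaw u = volume.withDensity Q ∧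
      ∀ x ∈ latentDomain M N, Q x = ENNReal.ofReal
        (|(fderiv ℝ (latentMap M N) x).det| * p u (latentMap M N x)) := by
  have hW := isOpen_latentDomain hA1 hmatch u
  set v := latentMap M N
  set W := latentDomain M N
  obtain ⟨hlaw, hpC, hppos⟩ := hA1 u
  set f : (Fin n → ℝ) → ENNReal := fun x => ENNReal.ofReal (|(fderiv ℝ v x).det| * p u (v x))
  have hfW : ContinuousOn f W := ENNReal.continuous_ofReal.comp_continuousOn
    ((continuousOn_det_fderiv_latentMap hW).mul
      (hpC.continuous.comp_continuousOn contDiffOn_latentMap.continuousOn))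
  -- Off `W` the map `v` takes arbitrary values of `Function.invFun`, so the density is cut off
  -- there; `Ẑ` has no mass outside `W`.
  refine ⟨W.indicator f, ?_, ?_, fun x hx => indicator_of_mem hx f⟩
  · rw [← piecewise_eq_indicator]
    exact hfW.measurable_piecewise continuousOn_const hW.measurableSet
  · ext S hS
    have hSW := hS.inter hW.measurableSet
    have hd : ∀ x ∈ S ∩ W, HasFDerivWithinAt v (fderiv ℝ v x) (S ∩ W) x := fun x hx =>
      ((contDiffOn_latentMap.contDiffAt (hW.mem_nhds hx.2)).differentiableAt
        two_ne_zero).hasFDerivAt.hasFDerivWithinAt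
    have hinj : InjOn v (S ∩ W) := injOn_latentMap.mono inter_subset_right
    rw [latentLaw_eq_latentLaw_image hmatch u hS, hlaw,
      withDensity_apply _ (measurable_image_of_fderivWithin hSW hd hinj),
      lintegral_image_eq_lintegral_abs_det_fderiv_mul _ hSW hd hinj, withDensity_apply _ hS,
      setLIntegral_indicator hW.measurableSet, inter_comm]
    refine lintegral_congr fun x => ?_
    exact (ENNReal.ofReal_mul (abs_nonneg _)).symm

end LatentMap

/-! ### Edge counting and linear algebra. -/

theorem SimpleGraph.card_ordered_edges {n : ℕ} (G : SimpleGraph (Fin n)) :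
    Nat.card {e : Fin n × Fin n // e.1 < e.2 ∧ G.Adj e.1 e.2} = G.edgeSet.ncard := by
  rw [← Nat.card_coe_set_eq]
  refine Nat.card_congr (Equiv.ofBijective
    (fun e => ⟨s(e.1.1, e.1.2), e.2.2⟩) ⟨?_, ?_⟩)
  · rintro ⟨⟨a, b⟩, hab, _⟩ ⟨⟨c, d⟩, hcd, _⟩ h
    rcases Sym2.eq_iff.1 (Subtype.ext_iff.1 h) with ⟨rfl, rfl⟩ | ⟨rfl, rfl⟩
    · rfl
    · exact absurd hab hcd.not_gt
  · rintro ⟨e, he⟩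
    induction e with
    | _ a b =>
      have hadj : G.Adj a b := he
      rcases lt_or_gt_of_ne hadj.ne with h | h
      · exact ⟨⟨(a, b), h, hadj⟩, rfl⟩
      · exact ⟨⟨(b, a), h, hadj.symm⟩, Subtype.ext Sym2.eq_swap⟩

theorem sum_sum_eq_sum_diag_add_sum_edges {n : ℕ} (G : SimpleGraph (Fin n))
    [Fintype {e : Fin n × Fin n // e.1 < e.2 ∧ G.Adj e.1 e.2}] (T : Fin n → Fin n → ℝ)
    (hT : ∀ i j, i ≠ j → ¬ G.Adj i j → T i j = 0) :
    ∑ i, ∑ j, T i j = ∑ i, T i i +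
      ∑ e : {e : Fin n × Fin n // e.1 < e.2 ∧ G.Adj e.1 e.2},
        (T e.1.1 e.1.2 + T e.1.2 e.1.1) := by
  classical
  have hsplit : ∀ i j, T i j = (if i = j then T i i else 0) +
      ((if i < j ∧ G.Adj i j then T i j else 0) + (if j < i ∧ G.Adj j i then T i j else 0)) := by
    intro i j
    rcases lt_trichotomy i j with h | rfl | h
    · by_cases hG : G.Adj i j
      · simp [h, h.ne, hG, h.not_gt]
      · simp [h, h.ne, hG, h.not_gt, hT i j h.ne hG]
    · simp
    · by_cases hG : G.Adj j i
      · simp [h, h.ne', hG, h.not_gt]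
      · simp [h, h.ne', hG, h.not_gt, hT i j h.ne' fun h' => hG h'.symm]
  have hedge : ∀ U : Fin n → Fin n → ℝ,
      ∑ e : {e : Fin n × Fin n // e.1 < e.2 ∧ G.Adj e.1 e.2}, U e.1.1 e.1.2 =
        ∑ i, ∑ j, if i < j ∧ G.Adj i j then U i j else 0 := by
    intro U
    rw [← Fintype.sum_prod_type' (fun i j => if i < j ∧ G.Adj i j then U i j else 0),
      ← Finset.sum_filter]
    exact (Finset.sum_subtype (p := fun e : Fin n × Fin n => e.1 < e.2 ∧ G.Adj e.1 e.2) _ (by simp)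
      fun e => U e.1 e.2).symm
  calc ∑ i, ∑ j, T i j
      = ∑ i, ∑ j, ((if i = j then T i i else 0) + ((if i < j ∧ G.Adj i j then T i j else 0) +
          (if j < i ∧ G.Adj j i then T i j else 0))) := by
        refine Finset.sum_congr rfl fun i _ => Finset.sum_congr rfl fun j _ => hsplit i j
    _ = _ := by
        simp only [Finset.sum_add_distrib, Finset.sum_ite_eq, Finset.mem_univ, if_true]
        rw [hedge T, hedge fun i j => T j i,
          Finset.sum_comm (f := fun i j => if j < i ∧ G.Adj j i then T i j else 0)]

/-- The family `w` is a basis by cardinality, so `c` is orthogonal to every vector, in particular to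
itself. -/
theorem eq_zero_of_sum_mul_eq_zero {ι κ : Type*} [Fintype ι] [Fintype κ] {w : κ → ι → ℝ}
    (hw : LinearIndependent ℝ w) (hcard : Fintype.card κ = Fintype.card ι) {c : ι → ℝ}
    (hc : ∀ k, ∑ i, w k i * c i = 0) : c = 0 := by
  have hspan := hw.span_eq_top_of_card_eq_finrank' (by simpa using hcard)
  have h : ∀ x : ι → ℝ, ∑ i, x i * c i = 0 := by
    intro x
    have hx : x ∈ Submodule.span ℝ (range w) := hspan ▸ Submodule.mem_top
    induction hx using Submodule.span_induction with
    | mem x hx => obtain ⟨k, rfl⟩ := hx; exact hc k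
    | zero => simp
    | add x y _ _ hx hy => simp only [Pi.add_apply, add_mul, Finset.sum_add_distrib, hx, hy, add_zero]
    | smul a x _ hx =>
      simp only [Pi.smul_apply, smul_eq_mul, mul_assoc, ← Finset.mul_sum, hx, mul_zero]
  funext i
  have := (Finset.sum_eq_zero_iff_of_nonneg fun i _ => mul_self_nonneg (c i)).1 (h c) i
    (Finset.mem_univ i)
  exact mul_self_eq_zero.1 this

/-! ### The second-order equation and the vanishing of its coefficients. -/

section

variable {n d : ℕ} {Par Par' : Fin n → Type*} {Dom : Type*}
  {M : GenerativeModel n d Par Dom} {N : GenerativeModel n d Par' Dom}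
  {p : Dom → (Fin n → ℝ) → ℝ}

theorem SmoothPositiveDensity.contDiff_log (hA1 : SmoothPositiveDensity M p) (u : Dom) :
    ContDiff ℝ 2 fun z => Real.log (p u z) :=
  (hA1 u).2.1.log fun z => ((hA1 u).2.2 z).ne'

/-- Non-adjacent latent variables have no mixed second derivative of the log-density. -/
theorem partialD_partialD_log_density_eq_zero (hA1 : SmoothPositiveDensity M p) {i j : Fin n}
    (hij : i ≠ j) (hadj : ¬ M.markovNetwork.Adj i j) (u : Dom) (z : Fin n → ℝ) :
    partialD i (partialD j fun y => Real.log (p u y)) z = 0 := by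
  have hci : CondIndepGivenRest (M.latentLaw u) i j := by
    by_contra h
    exact hadj ⟨hij, fun h' => h (h' u)⟩
  obtain ⟨hlaw, hpC, hpos⟩ := hA1 u
  exact partialD_partialD_eq_zero (hA1.contDiff_log u).contDiffAt
    (hci.log_density_add hij (ENNReal.measurable_ofReal.comp hpC.continuous.measurable) hlaw
      isOpen_univ (fun _ _ => rfl) hpC.continuous.continuousOn (fun y _ => hpos y) (mem_univ z))

/-- For non-adjacent estimated variables, the mixed second derivative of a log-likelihood ratio of
two domains vanishes: the Jacobian of the change of variables cancels. -/
theorem partialD_partialD_log_ratio_eq_zero (hA1 : SmoothPositiveDensity M p)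
    (hmatch : ∀ u, M.observedLaw u = N.observedLaw u) {k l : Fin n} (hkl : k ≠ l)
    (hadj : ¬ N.markovNetwork.Adj k l) (u u₀ : Dom) {x : Fin n → ℝ} (hx : x ∈ latentDomain M N) :
    partialD k (partialD l fun y => Real.log (p u (latentMap M N y)) -
      Real.log (p u₀ (latentMap M N y))) x = 0 := by
  have hW := isOpen_latentDomain hA1 hmatch u
  have hJ := fun y => det_fderiv_latentMap_pos (M := M) (N := N) hW (x := y)
  -- Since `v` is only `C²`, its Jacobian need not be twice differentiable. Hence the Jacobian terms
  -- are cancelled in the additive identities, before any differentiation.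
  have hlog : ∀ u, ∀ᶠ s : ℝ × ℝ in 𝓝 (0, 0),
      Real.log (|(fderiv ℝ (latentMap M N) x).det| * p u (latentMap M N x)) +
        Real.log (|(fderiv ℝ (latentMap M N) (x + Pi.single k s.1 + Pi.single l s.2)).det| *
          p u (latentMap M N (x + Pi.single k s.1 + Pi.single l s.2))) =
      Real.log (|(fderiv ℝ (latentMap M N) (x + Pi.single k s.1)).det| *
          p u (latentMap M N (x + Pi.single k s.1))) +
        Real.log (|(fderiv ℝ (latentMap M N) (x + Pi.single l s.2)).det| *
          p u (latentMap M N (x + Pi.single l s.2))) := by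
    intro u
    have hci : CondIndepGivenRest (N.latentLaw u) k l := by
      by_contra h
      exact hadj ⟨hkl, fun h' => h (h' u)⟩
    obtain ⟨Q, hQ, hlaw, hQW⟩ := latentLaw_eq_withDensity hA1 hmatch u
    exact hci.log_density_add hkl hQ hlaw hW hQW
      ((continuousOn_det_fderiv_latentMap hW).mul
        ((hA1 u).2.1.continuous.comp_continuousOn contDiffOn_latentMap.continuousOn))
      (fun y hy => mul_pos (hJ y hy) ((hA1 u).2.2 _)) hx
  have hv : ContDiffAt ℝ 2 (latentMap M N) x := contDiffOn_latentMap.contDiffAt (hW.mem_nhds hx)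
  refine partialD_partialD_eq_zero (((hA1.contDiff_log u).contDiffAt.comp x hv).sub
    ((hA1.contDiff_log u₀).contDiffAt.comp x hv)) ?_
  have hev : ∀ f : ℝ × ℝ → (Fin n → ℝ), Continuous f → f (0, 0) = x →
      ∀ᶠ s in 𝓝 (0, 0), f s ∈ latentDomain M N :=
    fun f hf h0 => hf.continuousAt.eventually_mem (hW.mem_nhds (h0 ▸ hx))
  have hk : Continuous fun s : ℝ × ℝ => (Pi.single k s.1 : Fin n → ℝ) :=
    (continuous_single k).comp continuous_fst
  have hl : Continuous fun s : ℝ × ℝ => (Pi.single l s.2 : Fin n → ℝ) :=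
    (continuous_single l).comp continuous_snd
  have hmul : ∀ u, ∀ y ∈ latentDomain M N,
      Real.log (|(fderiv ℝ (latentMap M N) y).det| * p u (latentMap M N y)) =
        Real.log |(fderiv ℝ (latentMap M N) y).det| + Real.log (p u (latentMap M N y)) :=
    fun u y hy => Real.log_mul (hJ y hy).ne' ((hA1 u).2.2 _).ne'
  filter_upwards [hlog u, hlog u₀,
    hev (fun s => x + Pi.single k s.1 + Pi.single l s.2) (by fun_prop) (by simp),
    hev (fun s => x + Pi.single k s.1) (by fun_prop) (by simp),
    hev (fun s => x + Pi.single l s.2) (by fun_prop) (by simp)] with s h₁ h₂ hab ha hb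
  rw [hmul _ _ hx, hmul _ _ hab, hmul _ _ ha, hmul _ _ hb] at h₁ h₂
  linarith

/-- Under sufficient changes, the coefficients of the second-order equation vanish. -/
theorem dLatent_relations (hA1 : SmoothPositiveDensity M p) (hA2 : SufficientChanges M p)
    (hmatch : ∀ u, M.observedLaw u = N.observedLaw u) {k l : Fin n} (hkl : k ≠ l)
    (hadj : ¬ N.markovNetwork.Adj k l) {x : Fin n → ℝ} (hx : x ∈ latentDomain M N) :
    (∀ i, dLatent M N i k x * dLatent M N i l x = 0) ∧
      ∀ i j, i < j → M.markovNetwork.Adj i j →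
        dLatent M N i k x * dLatent M N j l x + dLatent M N j k x * dLatent M N i l x = 0 := by
  classical
  let a : Fin n → ℝ := fun i => dLatent M N i k x
  let b : Fin n → ℝ := fun i => dLatent M N i l x
  obtain ⟨τ, hτ⟩ := hA2 (latentMap M N x)
  have hv : ContDiffAt ℝ 2 (latentMap M N) x :=
    contDiffOn_latentMap.contDiffAt ((isOpen_latentDomain hA1 hmatch (τ 0)).mem_nhds hx)
  -- The coefficients of the chain rule for `log p ∘ v`, indexed like `changeVector`.
  let c : Fin n ⊕ Fin n ⊕ {e : Fin n × Fin n // e.1 < e.2 ∧ M.markovNetwork.Adj e.1 e.2} → ℝ :=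
    Sum.elim (fun i => partialD k (partialD l fun y => latentMap M N y i) x)
      (Sum.elim (fun i => a i * b i)
        (fun e => a e.1.1 * b e.1.2 + a e.1.2 * b e.1.1))
  have hc : c = 0 := by
    refine eq_zero_of_sum_mul_eq_zero hτ ?_ fun r => ?_
    · have := M.markovNetwork.card_ordered_edges
      rw [Nat.card_eq_fintype_card] at this
      simp only [Fintype.card_fin, Fintype.card_sum, this]
      ring
    · have hu := hA1.contDiff_log (τ r.succ)
      have hu₀ := hA1.contDiff_log (τ 0)
      have h := partialD_partialD_log_ratio_eq_zero hA1 hmatch hkl hadj (τ r.succ) (τ 0) hx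
      have hF := hu.sub hu₀
      rw [partialD_partialD_comp (v := latentMap M N) hF hv] at h
      rw [sum_sum_eq_sum_diag_add_sum_edges M.markovNetwork] at h
      · simp only [c, changeVector, Fintype.sum_sum_type, Sum.elim_inl, Sum.elim_inr, Pi.sub_apply]
        simp only [partialD_partialD_fun_sub hu hu₀, partialD_fun_sub
          (hu.differentiable two_ne_zero _) (hu₀.differentiable two_ne_zero _)] at h
        refine Eq.trans ?_ h
        rw [add_comm]
        congr 2
        refine Finset.sum_congr rfl fun e _ => ?_
        -- The chain rule yields both orders of differentiation on an edge, `changeVector` only one;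
        -- symmetry merges them.
        rw [partialD_partialD_comm hu.contDiffAt e.1.2, partialD_partialD_comm hu₀.contDiffAt e.1.2]
        simp only [a, b, dLatent]
        ring
      · intro i j hij hGij
        rw [partialD_partialD_fun_sub hu hu₀,
          partialD_partialD_log_density_eq_zero hA1 hij.symm (fun h => hGij h.symm),
          partialD_partialD_log_density_eq_zero hA1 hij.symm (fun h => hGij h.symm)]
        ring
  refine ⟨fun i => congrFun hc (.inr (.inl i)), fun i j hij hGij => ?_⟩
  exact congrFun hc (.inr (.inr ⟨(i, j), hij, hGij⟩))

end

theorem mainTheorem4 {n d : ℕ} {Par Par' : Fin n → Type*} {Dom : Type*}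
    (M : GenerativeModel n d Par Dom) (N : GenerativeModel n d Par' Dom)
    (p : Dom → (Fin n → ℝ) → ℝ)
    (hA1 : SmoothPositiveDensity M p)
    (hA2 : SufficientChanges M p)
    (hmatch : ∀ u, M.observedLaw u = N.observedLaw u) :
    -- the derivatives below make sense: `v` is `C²` on an open set that contains `Ẑ` a.s.
    IsOpen (latentDomain M N) ∧
    (∀ u, ∀ᵐ zh ∂(N.latentLaw u), zh ∈ latentDomain M N) ∧
    ContDiffOn ℝ 2 (latentMap M N) (latentDomain M N) ∧
    -- the relations
    ∀ k l, k ≠ l → ¬ N.markovNetwork.Adj k l → ∀ zh ∈ latentDomain M N,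
      (∀ i, dLatent M N i k zh * dLatent M N i l zh = 0) ∧
      (∀ i j, M.markovNetwork.Adj i j → dLatent M N i k zh * dLatent M N j l zh = 0) := by
  -- Openness needs at least one domain; `τ 0` exists even when `2n + |M_Z| = 0`.
  obtain ⟨τ, -⟩ := hA2 0
  refine ⟨isOpen_latentDomain hA1 hmatch (τ 0), ae_mem_latentDomain hmatch, contDiffOn_latentMap,
    fun k l hkl hadj x hx => ?_⟩
  obtain ⟨h₁, h₂⟩ := dLatent_relations hA1 hA2 hmatch hkl hadj hx
  refine ⟨h₁, fun i j hij => ?_⟩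
  have hsum : dLatent M N i k x * dLatent M N j l x +
      dLatent M N j k x * dLatent M N i l x = 0 := by
    rcases lt_or_gt_of_ne hij.ne with h | h
    · exact h₂ i j h hij
    · rw [add_comm]
      exact h₂ j i h hij.symm
  -- One factor of the diagonal product at `i` is zero: either it kills the wanted product directly,
  -- or it kills the other summand of `hsum`.
  rcases mul_eq_zero.1 (h₁ i) with h | h
  · rw [h, zero_mul]
  · rwa [h, mul_zero, add_zero] at hsum
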